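/- Let $m$ and $e$ be integers with $m\ge 8$, $m\equiv 0 \pmod 4$, $1\le e\le m/2$ and $\gcd(m,e)=2$. Let $\alpha$ be a generator of $\mathbb{F}_{2^m}^*$, and for $\beta\in\mathbb{F}_{2^m}$ let $\mathbb{M}_\beta(x)$ denote the minimal polynomial of $\beta$ over $\mathbb{F}_2$. For $E=\{e\}$ let $\mathcal{C}_E$ be the binary cyclic code of length $2^m-1$ with generator polynomial $g_E(x)=\mathbb{M}_\alpha(x)\,\mathbb{M}_{\alpha^{1+2^e}}(x)$, that is, the set of vectors $(c_0,\dots,c_{2^m-2})\in\mathbb{F}_2^{2^m-1}$ such that the class of $\sum_i c_i x^i$ lies in the ideal of $\mathbb{F}_2[x]/(x^{2^m-1}-1)$ generated by $g_E(x)$. Let $\overline{\mathcal{C}_E}\subseteq\mathbb{F}_2^{2^m}$ be its extended code, in which each codeword gets one additional coordinate making the sum of all its coordinates $0$, and let $\overline{\mathcal{C}_E}^\perp$ be the dual of $\overline{\mathcal{C}_E}$ with respect to the standard inner product. (A linear code has parameters $[n,k,d]$ if it has length $n$, dimension $k$ and minimum Hamming weight $d$ of a nonzero codeword.) Then: 1.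 $\overline{\mathcal{C}_E}^\perp$ has parameters $[2^m,\ 2m+1,\ 2^{m-1}-2^{(m+2)/2}]$. 2. The numbers $A_w$ of codewords of Hamming weight $w$ in $\overline{\mathcal{C}_E}^\perp$ are $$A_0=A_{2^m}=1,\qquad A_{2^{m-1}}=2\,(3\cdot 2^{m-4}+1)(2^m-1),$$ $$A_{2^{m-1}-2^{(m+2)/2}}=A_{2^{m-1}+2^{(m+2)/2}}=\frac{2^{m-4}(2^m-1)}{5},$$ $$A_{2^{m-1}-2^{(m-2)/2}}=A_{2^{m-1}+2^{(m-2)/2}}=\frac{2^{m+2}(2^m-1)}{5},$$ and $A_w=0$ for every other $w$. 3. $\overline{\mathcal{C}_E}$ has parameters $[2^m,\ 2^m-1-2m,\ 4]$. -/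

import Mathlib

open Polynomial

noncomputable section

namespace BinaryCode

/-- The polynomial `c₀ + c₁ X + ⋯ + cₙ₋₁ Xⁿ⁻¹` of a vector, as a linear map. -/
def toPoly (K : Type*) [Field K] (n : ℕ) : (Fin n → K) →ₗ[K] K[X] :=
  ∑ i : Fin n, (Polynomial.monomial (i : ℕ)).comp (LinearMap.proj i)

/-- The cyclic code of length `n` generated by `g`: the vectors `c` whose class in
`K[X] / (Xⁿ - 1)` lies in the ideal generated by the class of `g`. -/
def cyclicCode {K : Type*} [Field K] (n : ℕ) (g : K[X]) : Submodule K (Fin n → K) where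
  carrier := {c | Ideal.Quotient.mk (Ideal.span {(X ^ n - 1 : K[X])}) (toPoly K n c) ∈
    Ideal.span {Ideal.Quotient.mk (Ideal.span {(X ^ n - 1 : K[X])}) g}}
  add_mem' := by
    intro a b ha hb
    simp only [Set.mem_ofPred_eq, map_add] at *
    exact Ideal.add_mem _ ha hb
  zero_mem' := by simp
  smul_mem' := by
    intro r a ha
    simp only [Set.mem_ofPred_eq, map_smul, Polynomial.smul_eq_C_mul, map_mul] at *
    exact Ideal.mul_mem_left _ _ ha

/-- The extended code: every codeword gets one more coordinate, which makes the sum of all its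
coordinates zero. -/
def extendedCode {K : Type*} [Field K] {n : ℕ} (C : Submodule K (Fin n → K)) :
    Submodule K (Fin (n + 1) → K) where
  carrier := {d | (fun i : Fin n => d i.castSucc) ∈ C ∧
    d (Fin.last n) = -∑ i : Fin n, d i.castSucc}
  add_mem' := by
    rintro a b ⟨ha, ha'⟩ ⟨hb, hb'⟩
    refine ⟨C.add_mem ha hb, ?_⟩
    simp only [Pi.add_apply, Finset.sum_add_distrib, ha', hb']
    ring
  zero_mem' := ⟨C.zero_mem, by simp⟩
  smul_mem' := by
    rintro r a ⟨ha, ha'⟩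
    refine ⟨C.smul_mem r ha, ?_⟩
    simp only [Pi.smul_apply, smul_eq_mul, ha', Finset.mul_sum, mul_neg]

/-- The dual code, with respect to the standard bilinear form. -/
def dualCode {K : Type*} [Field K] {ι : Type*} [Fintype ι] (C : Submodule K (ι → K)) :
    Submodule K (ι → K) where
  carrier := {x | ∀ c ∈ C, x ⬝ᵥ c = 0}
  add_mem' := by
    intro a b ha hb c hc
    rw [add_dotProduct, ha c hc, hb c hc, add_zero]
  zero_mem' := fun c _ => zero_dotProduct c
  smul_mem' := by
    intro r a ha c hc
    rw [smul_dotProduct, ha c hc, smul_zero]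

/-- `C` is an `[n, k, d]` linear code: length `n`, dimension `k`, and `d` is the smallest Hamming
weight of a nonzero codeword (it is attained). -/
def HasParameters {K : Type*} [Field K] [DecidableEq K] {ι : Type*} [Fintype ι]
    (C : Submodule K (ι → K)) (n k d : ℕ) : Prop :=
  Fintype.card ι = n ∧ Module.finrank K C = k ∧
    IsLeast {w : ℕ | ∃ c ∈ C, c ≠ 0 ∧ hammingNorm c = w} d

/-- The number of codewords of Hamming weight `w`. -/
def weightCount {K : Type*} [Field K] [DecidableEq K] {ι : Type*} [Fintype ι]
    (C : Submodule K (ι → K)) (w : ℕ) : ℕ :=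
  {c : ι → K | c ∈ C ∧ hammingNorm c = w}.ncard

/-- `g_E = M_α · lcm {M_{α^(1+2^e)} : e ∈ E}`, where `M_β` is the minimal polynomial of `β`
over the field with two elements and `lcm` is the monic least common multiple. -/
def genPoly {F : Type*} [Field F] [Algebra (ZMod 2) F] (α : Fˣ) (E : Finset ℕ) : (ZMod 2)[X] :=
  minpoly (ZMod 2) (α : F) * E.lcm (fun e => minpoly (ZMod 2) ((α : F) ^ (1 + 2 ^ e)))

/-- The binary cyclic code `C_E` of length `2^m - 1` with generator polynomial `g_E`. -/
def codeE {F : Type*} [Field F] [Algebra (ZMod 2) F] (m : ℕ) (α : Fˣ) (E : Finset ℕ) :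
    Submodule (ZMod 2) (Fin (2 ^ m - 1) → ZMod 2) :=
  cyclicCode (2 ^ m - 1) (genPoly α E)

end BinaryCode

end

/-!
Write `q = 2 ^ e`. A vector of length `2 ^ m` is indexed by the field `F`: the coordinate `i` stands
for `α ^ i` and the extra coordinate for `0`. As `α` and `α ^ (1 + q)` are not conjugate, their
minimal polynomials are coprime, and the extended code consists of the vectors `d` with
`∑ d x = 0`, `∑ d x * x = 0` and `∑ d x * x ^ (1 + q) = 0` (`mem_extendedCode_iff`). By
nondegeneracy of the trace form it is the dual of the code of all words
`x ↦ Tr (a x ^ (1 + q) + b x) + c` (`extendedCode_eq`), so that this trace code is its dual.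

The weight of such a word is `(2 ^ m ∓ W) / 2`, where `W = walsh e a b` is the sum of
`(-1) ^ Tr (a x ^ (1 + q) + b x)`. The function in the exponent is quadratic, and `W ^ 2` is
either `0` or `2 ^ m * r`, where `r` is the size of the radical of its polar form (`walsh_sq`);
Parseval's identity says that the second case holds for `2 ^ m / r` of the `b`
(`radCard_mul_card_walsh_sq`). Complementary words come in pairs, so only the squares matter.

For `a ≠ 0`, the nonzero elements `y` of the radical are the solutions of
`a ^ (q - 1) * y ^ (q ^ 2 - 1) = 1`. As `gcd (2 ^ m - 1, q - 1) = 3` and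
`gcd (2 ^ m - 1, q ^ 2 - 1) = 15`, the radical has size `1` or `16`, and counting the pairs `(a, y)`
in two ways shows that size `16` occurs for exactly one fifth of the `a`
(`five_mul_card_radCard_eq_sixteen`). This gives the weight distribution, which also shows that
`(a, b, c)` is determined by its word, and hence the dimensions.

The extended code has only even weights, no word of weight `2` because the points are distinct, and
the indicator of the subfield with four elements is a word of weight `4`.
-/

namespace BinaryCode

/-! ### Signed sums over finite groups -/

/-- The nontrivial character `(-1)^z` of the field with two elements, with integer values. -/
def sgn (z : ZMod 2) : ℤ := if z = 0 then 1 else -1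

lemma sgn_add (y z : ZMod 2) : sgn (y + z) = sgn y * sgn z := by
  revert y z; decide

@[simp] lemma sgn_zero : sgn 0 = 1 := rfl

lemma sgn_one : sgn 1 = -1 := by decide

lemma zmod_two_eq_zero_or_one (z : ZMod 2) : z = 0 ∨ z = 1 := by
  revert z; decide

open Classical in
lemma sum_sgn_addMonoidHom {G : Type*} [AddCommGroup G] [Fintype G] (φ : G →+ ZMod 2) :
    ∑ x, sgn (φ x) = if φ = 0 then (Fintype.card G : ℤ) else 0 := by
  split_ifs with h
  · simp [h]
  · obtain ⟨g, hg⟩ : ∃ g, φ g ≠ 0 := by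
      by_contra! hc
      exact h (AddMonoidHom.ext hc)
    have hg1 : φ g = 1 := (zmod_two_eq_zero_or_one _).resolve_left hg
    have := Equiv.sum_comp (Equiv.addRight g) (fun x => sgn (φ x))
    simp only [Equiv.coe_addRight, map_add, sgn_add, hg1, sgn_one, mul_neg, mul_one,
      Finset.sum_neg_distrib] at this
    omega

open Classical in
/-- The square of the signed sum of a quadratic function `f` is governed by the radical of its
polar form: it is `|V|` times the sum of the additive function `f` over the radical. -/
lemma sq_sum_sgn_of_polar {V : Type*} [AddCommGroup V] [Fintype V] (f : V → ZMod 2)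
    (B : V →+ V →+ ZMod 2) (hf : ∀ x y, f (x + y) = f x + f y + B y x) :
    (∑ x, sgn (f x)) ^ 2 = if ∀ y, B y = 0 → f y = 0
      then (Fintype.card V : ℤ) * Fintype.card {y // B y = 0} else 0 := by
  have h1 : (∑ x, sgn (f x)) ^ 2
      = (Fintype.card V : ℤ) * ∑ y : {y // B y = 0}, sgn (f y) := by
    have hkey : ∀ x y, sgn (f x) * sgn (f (x + y)) = sgn (f y) * sgn (B y x) := by
      intro x y
      rw [hf, ← sgn_add, ← sgn_add]
      congr 1
      linear_combination CharTwo.add_self_eq_zero (f x)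
    calc (∑ x, sgn (f x)) ^ 2 = ∑ x, ∑ y, sgn (f x) * sgn (f y) := by
          rw [sq, Finset.sum_mul_sum]
      _ = ∑ x, ∑ y, sgn (f x) * sgn (f (x + y)) := by
          refine Finset.sum_congr rfl fun x _ => ?_
          exact (Equiv.sum_comp (Equiv.addLeft x) (fun y => sgn (f x) * sgn (f y))).symm
      _ = ∑ y, sgn (f y) * ∑ x, sgn (B y x) := by
          simp_rw [hkey]
          rw [Finset.sum_comm]
          simp_rw [Finset.mul_sum]
      _ = ∑ y, if B y = 0 then (Fintype.card V : ℤ) * sgn (f y) else 0 := by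
          refine Finset.sum_congr rfl fun y _ => ?_
          rw [sum_sgn_addMonoidHom]
          split_ifs <;> ring
      _ = _ := by
          rw [← Finset.sum_filter, Finset.mul_sum]
          exact Finset.sum_subtype _ (by simp) _
  -- on the radical the function is additive
  let φ : B.ker →+ ZMod 2 :=
    { toFun := fun y => f y
      map_zero' := by
        have := hf 0 0
        simpa using this
      map_add' := fun x y => by
        have hy : B y = 0 := y.2
        simp [hf, hy] }
  let _ : Fintype B.ker := inferInstanceAs (Fintype {y // B y = 0})
  have h2 : ∑ y : {y // B y = 0}, sgn (f y) = ∑ y : B.ker, sgn (φ y) := rfl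
  rw [h1, h2, sum_sgn_addMonoidHom]
  have h3 : φ = 0 ↔ ∀ y, B y = 0 → f y = 0 := by
    constructor
    · intro h y hy
      exact DFunLike.congr_fun h (⟨y, hy⟩ : B.ker)
    · intro h
      ext y
      exact h y y.2
  simp only [h3]
  split_ifs
  · rfl
  · simp

/-! ### Walsh sums of the quadratic forms `Tr (a x ^ (1 + 2 ^ e))` -/

section Walsh

variable {F : Type*} [Field F] [Fintype F] [Algebra (ZMod 2) F]

/-- The absolute trace. -/
noncomputable abbrev tr (x : F) : ZMod 2 := Algebra.trace (ZMod 2) F x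

lemma tr_mul_eq_zero {a : F} (h : ∀ x, tr (x * a) = 0) : a = 0 := by
  refine (traceForm_nondegenerate (ZMod 2) F).1 a fun x => ?_
  rw [Algebra.traceForm_apply, mul_comm]
  exact h x

/-- The `e`-th power of the Frobenius automorphism. -/
noncomputable def frob (F : Type*) [Field F] [Fintype F] [Algebra (ZMod 2) F] (e : ℕ) :
    F ≃ₐ[ZMod 2] F :=
  FiniteField.frobeniusAlgEquivOfAlgebraic (ZMod 2) F ^ e

lemma frob_apply (e : ℕ) (x : F) : frob F e x = x ^ 2 ^ e := by
  rw [frob, AlgEquiv.coe_pow, FiniteField.coe_frobeniusAlgEquivOfAlgebraic_iterate, ZMod.card]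

lemma tr_pow_two_pow (e : ℕ) (x : F) : tr (x ^ 2 ^ e) = tr x := by
  rw [← frob_apply]
  exact Algebra.trace_eq_of_algEquiv (frob F e) x

/-- The function `Tr (a x ^ (1 + 2 ^ e) + b x)`. -/
noncomputable def quadFun (e : ℕ) (a b x : F) : ZMod 2 := tr (a * x ^ (1 + 2 ^ e) + b * x)

/-- The polar form of `quadFun e a b`. It does not depend on `b`. -/
noncomputable def polarForm (e : ℕ) (a : F) : F →+ F →+ ZMod 2 :=
  AddMonoidHom.mk' (fun y => AddMonoidHom.mk'
    (fun x => tr (a * (x ^ 2 ^ e * y + x * y ^ 2 ^ e)))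
    (fun x x' => by
      simp only [← frob_apply, map_add (frob F e), ← map_add (Algebra.trace (ZMod 2) F)]
      congr 1
      ring))
    (fun y y' => by
      ext x
      simp only [AddMonoidHom.mk'_apply, AddMonoidHom.add_apply, ← frob_apply,
        map_add (frob F e), ← map_add (Algebra.trace (ZMod 2) F)]
      congr 1
      ring)

lemma polarForm_apply (e : ℕ) (a y x : F) :
    polarForm e a y x = tr (a * (x ^ 2 ^ e * y + x * y ^ 2 ^ e)) := rfl

lemma quadFun_add (e : ℕ) (a b x y : F) :
    quadFun e a b (x + y) = quadFun e a b x + quadFun e a b y + polarForm e a y x := by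
  simp only [quadFun, polarForm_apply, ← map_add (Algebra.trace (ZMod 2) F), pow_add, pow_one,
    ← frob_apply, map_add (frob F e)]
  congr 1
  ring

/-- The radical of the polar form: move the Frobenius power to the other argument by invariance of
the trace, and use that the trace form is nondegenerate. -/
lemma polarForm_eq_zero_iff (e : ℕ) (a y : F) :
    polarForm e a y = 0 ↔ a * y + a ^ 2 ^ e * y ^ 2 ^ (2 * e) = 0 := by
  have key : ∀ x, polarForm e a y x = tr (frob F e x * (a * y + a ^ 2 ^ e * y ^ 2 ^ (2 * e))) := by
    intro x
    have h := tr_pow_two_pow e (a * (x * y ^ 2 ^ e))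
    rw [polarForm_apply, mul_add, tr, map_add, ← tr, ← tr, ← h, ← map_add]
    congr 1
    rw [frob_apply, two_mul e, pow_add 2 e e, pow_mul]
    ring
  constructor
  · intro h
    refine tr_mul_eq_zero fun z => ?_
    obtain ⟨x, rfl⟩ := (frob F e).surjective z
    rw [← key, h, AddMonoidHom.zero_apply]
  · intro h
    ext x
    rw [key, h]
    simp

/-- The sum of `(-1) ^ Tr (a x ^ (1 + 2 ^ e) + b x)` over the field. -/
noncomputable def walsh (e : ℕ) (a b : F) : ℤ := ∑ x, sgn (quadFun e a b x)

/-- The size of the radical of the quadratic form `Tr (a x ^ (1 + 2 ^ e))`. -/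
noncomputable def radCard (e : ℕ) (a : F) : ℕ := Nat.card {y // polarForm e a y = 0}

lemma walsh_sq (e : ℕ) (a b : F) : walsh e a b ^ 2 = 0 ∨
    walsh e a b ^ 2 = (Fintype.card F : ℤ) * radCard e a := by
  classical
  rw [walsh, sq_sum_sgn_of_polar _ (polarForm e a) (quadFun_add e a b), radCard,
    Nat.card_eq_fintype_card]
  split_ifs
  · right; rfl
  · left; rfl

/-- Parseval's identity. -/
lemma sum_walsh_sq (e : ℕ) (a : F) : ∑ b, walsh e a b ^ 2 = (Fintype.card F : ℤ) ^ 2 := by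
  classical
  have h : ∀ x y b, sgn (quadFun e a b x) * sgn (quadFun e a b y)
      = sgn (quadFun e a 0 x) * sgn (quadFun e a 0 y)
        * sgn ((Algebra.trace (ZMod 2) F).toAddMonoidHom.comp (AddMonoidHom.mulRight (x + y)) b)
      := by
    intro x y b
    have hb : (Algebra.trace (ZMod 2) F).toAddMonoidHom.comp (AddMonoidHom.mulRight (x + y)) b
      = tr (b * (x + y)) := rfl
    rw [hb, ← sgn_add, ← sgn_add, ← sgn_add, quadFun, quadFun, quadFun, quadFun,
      ← map_add, ← map_add, ← map_add]
    congr 2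
    ring
  have h0 : ∀ z : F, (Algebra.trace (ZMod 2) F).toAddMonoidHom.comp (AddMonoidHom.mulRight z) = 0
      ↔ z = 0 := by
    intro z
    constructor
    · intro hz
      exact tr_mul_eq_zero fun x => DFunLike.congr_fun hz x
    · rintro rfl
      refine AddMonoidHom.ext fun x => ?_
      change tr (x * 0) = 0
      rw [mul_zero]
      exact map_zero _
  have : CharP F 2 := charP_of_injective_algebraMap (algebraMap (ZMod 2) F).injective 2
  calc ∑ b, walsh e a b ^ 2
      = ∑ b, ∑ x, ∑ y, sgn (quadFun e a b x) * sgn (quadFun e a b y) := by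
        simp_rw [walsh, sq, Finset.sum_mul_sum]
    _ = ∑ x, ∑ y, ∑ b, sgn (quadFun e a b x) * sgn (quadFun e a b y) := by
        rw [Finset.sum_comm]
        exact Finset.sum_congr rfl fun x _ => Finset.sum_comm
    _ = ∑ x : F, ∑ y : F, if x = y then (Fintype.card F : ℤ) else 0 := by
        refine Finset.sum_congr rfl fun x _ => Finset.sum_congr rfl fun y _ => ?_
        rw [Finset.sum_congr rfl fun b _ => h x y b, ← Finset.mul_sum, sum_sgn_addMonoidHom]
        simp only [h0, CharTwo.add_eq_zero]
        split_ifs with hxy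
        · subst hxy
          rw [← sgn_add, CharTwo.add_self_eq_zero, sgn_zero, one_mul]
        · simp
    _ = _ := by
        simp [sq]

open Classical in
lemma radCard_mul_card_walsh_sq (e : ℕ) (a : F) :
    radCard e a * (Finset.univ.filter fun b : F =>
      walsh e a b ^ 2 = (Fintype.card F : ℤ) * radCard e a).card = Fintype.card F := by
  have h := sum_walsh_sq e a
  -- every nonzero term of Parseval's sum has the same value
  have h2 : ∀ b, walsh e a b ^ 2 = if walsh e a b ^ 2 = (Fintype.card F : ℤ) * radCard e a
      then (Fintype.card F : ℤ) * radCard e a else 0 := by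
    intro b
    split_ifs with hb
    · exact hb
    · exact (walsh_sq e a b).resolve_right hb
  rw [Finset.sum_congr rfl fun b _ => h2 b, ← Finset.sum_filter, Finset.sum_const,
    nsmul_eq_mul] at h
  have hc : (Fintype.card F : ℤ) ≠ 0 := by exact_mod_cast Fintype.card_ne_zero
  have h3 : (radCard e a : ℤ) * (Finset.univ.filter fun b : F =>
      walsh e a b ^ 2 = (Fintype.card F : ℤ) * radCard e a).card = Fintype.card F := by
    apply mul_left_cancel₀ hc
    linarith
  exact_mod_cast h3

open Classical in
/-- The number of pairs with a given nonzero square of the Walsh sum, in terms of the number of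
quadratic forms whose radical has the corresponding size. -/
lemma mul_card_walsh_sq_eq (e r : ℕ) (hr : 0 < r) :
    r * (Finset.univ.filter fun p : F × F =>
      walsh e p.1 p.2 ^ 2 = (Fintype.card F : ℤ) * r).card
      = Fintype.card F * (Finset.univ.filter fun a : F => radCard e a = r).card := by
  have hc : (Fintype.card F : ℤ) ≠ 0 := by exact_mod_cast Fintype.card_ne_zero
  have h : ∀ a : F, r * (∑ b : F, if walsh e a b ^ 2 = (Fintype.card F : ℤ) * r then 1 else 0)
      = if radCard e a = r then Fintype.card F else 0 := by
    intro a
    rw [← Finset.card_filter]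
    split_ifs with ha
    · subst ha
      exact radCard_mul_card_walsh_sq e a
    · rw [Finset.filter_eq_empty_iff.2, Finset.card_empty, mul_zero]
      intro b _ hb
      rcases walsh_sq e a b with h0 | h0 <;> rw [h0] at hb
      · have : (Fintype.card F : ℤ) * r ≠ 0 := mul_ne_zero hc (by exact_mod_cast hr.ne')
        exact this hb.symm
      · exact ha (by exact_mod_cast mul_left_cancel₀ hc hb)
  rw [Finset.card_filter, Fintype.sum_prod_type, Finset.mul_sum]
  simp_rw [h]
  rw [← Finset.sum_filter, Finset.sum_const, smul_eq_mul, mul_comm]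

end Walsh

/-! ### Sizes of the radicals -/

lemma gcd_two_pow_sub_one_two_pow_sub_one {m e : ℕ} (hgcd : Nat.gcd m e = 2) :
    Nat.gcd (2 ^ m - 1) (2 ^ e - 1) = 3 := by
  rw [Nat.pow_sub_one_gcd_pow_sub_one, hgcd]
  norm_num

lemma gcd_two_pow_sub_one_two_pow_two_mul_sub_one {m e : ℕ} (hm4 : m % 4 = 0)
    (hgcd : Nat.gcd m e = 2) : Nat.gcd (2 ^ m - 1) (2 ^ (2 * e) - 1) = 15 := by
  have h : Nat.gcd m (2 * e) = 4 := by
    obtain ⟨k, rfl⟩ := Nat.dvd_of_mod_eq_zero hm4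
    apply Nat.dvd_antisymm
    · have h1 : Nat.gcd (4 * k) (2 * e) ∣ Nat.gcd (2 * (4 * k)) (2 * e) :=
        Nat.gcd_dvd_gcd_of_dvd_left _ (Dvd.intro_left 2 rfl)
      rwa [Nat.gcd_mul_left, hgcd] at h1
    · have h2 : 2 ∣ e := hgcd ▸ Nat.gcd_dvd_right (4 * k) e
      refine Nat.dvd_gcd (Dvd.intro k rfl) ?_
      obtain ⟨j, rfl⟩ := h2
      exact ⟨j, by ring⟩
  rw [Nat.pow_sub_one_gcd_pow_sub_one, h]
  norm_num

/-- In a finite cyclic group of order `n`, an equation `z ^ d = c` with a solution has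
`gcd n d` solutions. -/
lemma card_filter_pow_eq {G : Type*} [CommGroup G] [IsCyclic G] [Fintype G] (d : ℕ) {c z₀ : G}
    (h₀ : z₀ ^ d = c) {p : G → Prop} [DecidablePred p] (hp : ∀ z, p z ↔ z ^ d = c) :
    (Finset.univ.filter p).card = Nat.gcd (Nat.card G) d := by
  classical
  rw [← IsCyclic.card_powMonoidHom_ker, Nat.card_eq_fintype_card, ← Fintype.card_subtype]
  refine Fintype.card_congr ((Equiv.mulLeft z₀⁻¹).subtypeEquiv fun z => ?_)
  rw [hp, MonoidHom.mem_ker, powMonoidHom_apply, Equiv.coe_mulLeft, mul_pow, inv_pow, h₀,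
    inv_mul_eq_one, eq_comm]

lemma card_units_eq {F : Type*} [Field F] [Fintype F] {m : ℕ}
    (hF : Fintype.card F = 2 ^ m) : Nat.card Fˣ = 2 ^ m - 1 := by
  rw [Nat.card_units, Nat.card_eq_fintype_card, hF]

lemma sixteen_lt_two_pow {m : ℕ} (hm : 8 ≤ m) : 16 < 2 ^ m :=
  lt_of_lt_of_le (by norm_num) (Nat.pow_le_pow_right two_pos hm)

section Radical

variable {F : Type*} [Field F] [Fintype F] [Algebra (ZMod 2) F]

lemma polarForm_units_eq_zero_iff (e : ℕ) (u z : Fˣ) :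
    polarForm e (u : F) z = 0 ↔ u ^ (2 ^ e - 1) * z ^ (2 ^ (2 * e) - 1) = 1 := by
  have : CharP F 2 := charP_of_injective_algebraMap (algebraMap (ZMod 2) F).injective 2
  have h1 : (2 ^ e - 1) + 1 = 2 ^ e := Nat.sub_add_cancel Nat.one_le_two_pow
  have h2 : (2 ^ (2 * e) - 1) + 1 = 2 ^ (2 * e) := Nat.sub_add_cancel Nat.one_le_two_pow
  rw [polarForm_eq_zero_iff, CharTwo.add_eq_zero, ← h1, ← h2]
  simp only [Nat.add_sub_cancel]
  have h3 : (u ^ (2 ^ e - 1) * z ^ (2 ^ (2 * e) - 1)) * (u * z)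
      = u ^ (2 ^ e - 1 + 1) * z ^ (2 ^ (2 * e) - 1 + 1) := by
    rw [pow_succ, pow_succ]
    exact mul_mul_mul_comm _ _ _ _
  constructor
  · intro h
    have h4 : u * z = u ^ (2 ^ e - 1 + 1) * z ^ (2 ^ (2 * e) - 1 + 1) := by
      ext
      push_cast
      exact h
    rw [← h3] at h4
    exact mul_eq_right.1 h4.symm
  · intro h
    rw [h, one_mul] at h3
    exact_mod_cast congrArg Units.val h3

open Classical in
lemma radCard_units (e : ℕ) (u : Fˣ) : radCard e (u : F) = (Finset.univ.filter fun z : Fˣ =>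
    u ^ (2 ^ e - 1) * z ^ (2 ^ (2 * e) - 1) = 1).card + 1 := by
  have h : (Finset.univ.filter fun y : F => polarForm e (u : F) y = 0)
      = insert 0 ((Finset.univ.filter fun z : Fˣ =>
        u ^ (2 ^ e - 1) * z ^ (2 ^ (2 * e) - 1) = 1).map ⟨Units.val, Units.val_injective⟩) := by
    ext y
    simp only [Finset.mem_filter, Finset.mem_univ, true_and, Finset.mem_insert, Finset.mem_map,
      Function.Embedding.coeFn_mk]
    constructor
    · intro hy
      by_cases h0 : y = 0
      · exact Or.inl h0
      · exact Or.inr ⟨Units.mk0 y h0, (polarForm_units_eq_zero_iff e u _).1 hy, rfl⟩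
    · rintro (rfl | ⟨z, hz, rfl⟩)
      · exact map_zero _
      · exact (polarForm_units_eq_zero_iff e u z).2 hz
  rw [radCard, Nat.card_eq_fintype_card, Fintype.card_subtype, h, Finset.card_insert_of_notMem,
    Finset.card_map]
  simp

lemma radCard_zero (e : ℕ) : radCard e (0 : F) = Fintype.card F := by
  classical
  rw [radCard, Nat.card_eq_fintype_card, Fintype.card_subtype, Finset.filter_true_of_mem,
    Finset.card_univ]
  intro y _
  rw [polarForm_eq_zero_iff]
  simp

variable {m e : ℕ} (hm4 : m % 4 = 0) (hgcd : Nat.gcd m e = 2) (hF : Fintype.card F = 2 ^ m)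

include hm4 hgcd hF

lemma radCard_units_eq_one_or (u : Fˣ) : radCard e (u : F) = 1 ∨ radCard e (u : F) = 16 := by
  classical
  rw [radCard_units]
  by_cases h : ∃ z₀ : Fˣ, u ^ (2 ^ e - 1) * z₀ ^ (2 ^ (2 * e) - 1) = 1
  · right
    obtain ⟨z₀, h₀⟩ := h
    have h : ∀ z : Fˣ, u ^ (2 ^ e - 1) * z ^ (2 ^ (2 * e) - 1) = 1 ↔
        z ^ (2 ^ (2 * e) - 1) = (u ^ (2 ^ e - 1))⁻¹ := fun z => by
      rw [mul_eq_one_iff_inv_eq, eq_comm]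
    rw [card_filter_pow_eq _ ((h z₀).1 h₀) h, card_units_eq hF,
      gcd_two_pow_sub_one_two_pow_two_mul_sub_one hm4 hgcd]
  · left
    push Not at h
    simp [h]

open Classical in
/-- Exactly one fifth of the nonzero `a` have a radical of size `16`: count the pairs `(u, z)` with
`u ^ (2 ^ e - 1) * z ^ (2 ^ (2 * e) - 1) = 1` in two ways. Every such `u` has `15` partners `z`, and
every `z` has `3` partners `u`, as `u = z⁻¹ ^ (2 ^ e + 1)` is one of them. -/
lemma five_mul_card_radCard_eq_sixteen_units :
    5 * (Finset.univ.filter fun u : Fˣ => radCard e (u : F) = 16).card = 2 ^ m - 1 := by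
  have h1 : ∑ u : Fˣ, (Finset.univ.filter fun z : Fˣ =>
      u ^ (2 ^ e - 1) * z ^ (2 ^ (2 * e) - 1) = 1).card
      = (Finset.univ.filter fun u : Fˣ => radCard e (u : F) = 16).card * 15 := by
    have h : ∀ u : Fˣ, (Finset.univ.filter fun z : Fˣ =>
        u ^ (2 ^ e - 1) * z ^ (2 ^ (2 * e) - 1) = 1).card
        = if radCard e (u : F) = 16 then 15 else 0 := by
      intro u
      have hu := radCard_units e u
      have hu' := radCard_units_eq_one_or hm4 hgcd hF u
      split_ifs <;> omega
    simp_rw [h]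
    rw [← Finset.sum_filter, Finset.sum_const, smul_eq_mul]
  have h2 : ∑ u : Fˣ, (Finset.univ.filter fun z : Fˣ =>
      u ^ (2 ^ e - 1) * z ^ (2 ^ (2 * e) - 1) = 1).card = (2 ^ m - 1) * 3 := by
    simp_rw [Finset.card_filter]
    rw [Finset.sum_comm]
    simp_rw [← Finset.card_filter]
    have h : ∀ z : Fˣ, (Finset.univ.filter fun u : Fˣ =>
        u ^ (2 ^ e - 1) * z ^ (2 ^ (2 * e) - 1) = 1).card = 3 := by
      intro z
      have hz : (z⁻¹ ^ (2 ^ e + 1)) ^ (2 ^ e - 1) = (z ^ (2 ^ (2 * e) - 1))⁻¹ := by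
        rw [← pow_mul, ← inv_pow, ← Nat.sq_sub_sq, one_pow, ← pow_mul, mul_comm e 2]
      rw [card_filter_pow_eq _ hz fun u => mul_eq_one_iff_eq_inv, card_units_eq hF,
        gcd_two_pow_sub_one_two_pow_sub_one hgcd]
    simp_rw [h]
    rw [Finset.sum_const, Finset.card_univ, ← Nat.card_eq_fintype_card, card_units_eq hF,
      smul_eq_mul]
  omega

lemma radCard_eq (a : F) : (a = 0 ∧ radCard e a = 2 ^ m) ∨
    (a ≠ 0 ∧ radCard e a = 1) ∨ (a ≠ 0 ∧ radCard e a = 16) := by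
  by_cases h0 : a = 0
  · left
    exact ⟨h0, by rw [h0, radCard_zero, hF]⟩
  · right
    have := radCard_units_eq_one_or hm4 hgcd hF (Units.mk0 a h0)
    simpa [h0] using this

lemma walsh_sq_eq (a b : F) : walsh e a b ^ 2 = 0 ∨ walsh e a b ^ 2 = 2 ^ m ∨
    walsh e a b ^ 2 = 2 ^ m * 16 ∨ walsh e a b ^ 2 = 2 ^ m * 2 ^ m := by
  have h := walsh_sq e a b
  rw [hF] at h
  rcases h with h | h
  · exact Or.inl h
  · rw [h]
    rcases radCard_eq hm4 hgcd hF a with h1 | h1 | h1 <;> rw [h1.2] <;> simp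

variable (hm : 8 ≤ m)

include hm

open Classical in
lemma five_mul_card_radCard_eq_sixteen :
    5 * (Finset.univ.filter fun a : F => radCard e a = 16).card = 2 ^ m - 1 := by
  rw [← five_mul_card_radCard_eq_sixteen_units hm4 hgcd hF]
  congr 1
  rw [← Finset.card_map ⟨Units.val, Units.val_injective⟩]
  congr 1
  ext a
  simp only [Finset.mem_filter, Finset.mem_univ, true_and, Finset.mem_map,
    Function.Embedding.coeFn_mk]
  constructor
  · intro ha
    have h0 : a ≠ 0 := by
      rintro rfl
      rw [radCard_zero, hF] at ha
      have : 16 < 2 ^ m := sixteen_lt_two_pow hm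
      omega
    exact ⟨Units.mk0 a h0, ha, rfl⟩
  · rintro ⟨u, hu, rfl⟩
    exact hu

open Classical in
lemma card_radCard_eq_two_pow :
    (Finset.univ.filter fun a : F => radCard e a = 2 ^ m).card = 1 := by
  have h16 : 16 < 2 ^ m := sixteen_lt_two_pow hm
  rw [Finset.card_eq_one]
  refine ⟨0, ?_⟩
  ext a
  simp only [Finset.mem_filter, Finset.mem_univ, true_and, Finset.mem_singleton]
  have := radCard_eq hm4 hgcd hF a
  constructor
  · intro h
    rcases this with h1 | h1 | h1
    · exact h1.1
    · omega
    · omega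
  · intro h
    subst h
    rw [radCard_zero, hF]

open Classical in
lemma card_radCard_eq_one : 5 * (Finset.univ.filter fun a : F => radCard e a = 1).card
    = 4 * (2 ^ m - 1) := by
  have h16 : 16 < 2 ^ m := sixteen_lt_two_pow hm
  have h1 := five_mul_card_radCard_eq_sixteen hm4 hgcd hF hm
  have h2 := card_radCard_eq_two_pow hm4 hgcd hF hm
  have h3 : (Finset.univ.filter fun a : F => radCard e a = 1).card
      + (Finset.univ.filter fun a : F => radCard e a = 16).card
      + (Finset.univ.filter fun a : F => radCard e a = 2 ^ m).card = 2 ^ m := by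
    have hc : ∑ _a : F, 1 = 2 ^ m := by rw [← hF, Finset.card_univ.symm, Finset.card_eq_sum_ones]
    refine Eq.trans ?_ hc
    rw [Finset.card_filter, Finset.card_filter, Finset.card_filter, ← Finset.sum_add_distrib,
      ← Finset.sum_add_distrib]
    refine Finset.sum_congr rfl fun a _ => ?_
    have := radCard_eq hm4 hgcd hF a
    split_ifs <;> omega
  omega

/-! ### The value distribution of the Walsh sums -/

open Classical in
lemma card_walsh_sq_eq_two_pow : 5 * (Finset.univ.filter fun p : F × F =>
    walsh e p.1 p.2 ^ 2 = 2 ^ m).card = 2 ^ m * (4 * (2 ^ m - 1)) := by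
  have h := mul_card_walsh_sq_eq (F := F) e 1 one_pos
  rw [hF, one_mul] at h
  push_cast at h
  rw [mul_one] at h
  rw [h, ← card_radCard_eq_one hm4 hgcd hF hm]
  ring

open Classical in
lemma card_walsh_sq_eq_two_pow_mul_sixteen : 80 * (Finset.univ.filter fun p : F × F =>
    walsh e p.1 p.2 ^ 2 = 2 ^ m * 16).card = 2 ^ m * (2 ^ m - 1) := by
  have h := mul_card_walsh_sq_eq (F := F) e 16 (by norm_num)
  rw [hF] at h
  push_cast at h
  rw [← five_mul_card_radCard_eq_sixteen hm4 hgcd hF hm]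
  linarith

open Classical in
lemma card_walsh_sq_eq_two_pow_mul_two_pow : (Finset.univ.filter fun p : F × F =>
    walsh e p.1 p.2 ^ 2 = 2 ^ m * 2 ^ m).card = 1 := by
  have h := mul_card_walsh_sq_eq (F := F) e (2 ^ m) (by positivity)
  rw [hF, card_radCard_eq_two_pow hm4 hgcd hF hm] at h
  push_cast at h
  exact Nat.eq_of_mul_eq_mul_left (by positivity) h

open Classical in
lemma card_walsh_sq_add : (Finset.univ.filter fun p : F × F => walsh e p.1 p.2 ^ 2 = 0).card
    + (Finset.univ.filter fun p : F × F => walsh e p.1 p.2 ^ 2 = 2 ^ m).card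
    + (Finset.univ.filter fun p : F × F => walsh e p.1 p.2 ^ 2 = 2 ^ m * 16).card
    + (Finset.univ.filter fun p : F × F => walsh e p.1 p.2 ^ 2 = 2 ^ m * 2 ^ m).card
    = 2 ^ m * 2 ^ m := by
  have h16 : (16 : ℤ) < 2 ^ m := by
    exact_mod_cast sixteen_lt_two_pow hm
  have hc : ∑ _p : F × F, 1 = 2 ^ m * 2 ^ m := by
    rw [← hF, ← Fintype.card_prod, Finset.card_univ.symm, Finset.card_eq_sum_ones]
  refine Eq.trans ?_ hc
  rw [Finset.card_filter, Finset.card_filter, Finset.card_filter, Finset.card_filter,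
    ← Finset.sum_add_distrib, ← Finset.sum_add_distrib, ← Finset.sum_add_distrib]
  refine Finset.sum_congr rfl fun p _ => ?_
  have h1 : (2 : ℤ) ^ m * 2 ^ m ≠ 2 ^ m * 16 := by nlinarith
  have h2 : (2 : ℤ) ^ m * 2 ^ m ≠ 2 ^ m := by nlinarith
  have h3 : (2 : ℤ) ^ m * 2 ^ m ≠ 0 := by nlinarith
  rcases walsh_sq_eq hm4 hgcd hF p.1 p.2 with h | h | h | h <;> rw [h] <;>
    split_ifs <;> omega

end Radical

/-! ### Dual codes -/

section Dual

variable {K : Type*} [Field K] {ι : Type*} [Fintype ι]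

/-- The standard bilinear form on `ι → K`. -/
noncomputable def dotForm (K ι : Type*) [Field K] [Fintype ι] : LinearMap.BilinForm K (ι → K) :=
  dotProductBilin K K

lemma dotForm_apply (x y : ι → K) : dotForm K ι x y = x ⬝ᵥ y := rfl

lemma dotForm_isRefl : (dotForm K ι).IsRefl := fun x y h => by
  rw [dotForm_apply, dotProduct_comm, ← dotForm_apply]
  exact h

lemma dotForm_nondegenerate : (dotForm K ι).Nondegenerate := by
  refine ⟨fun x h => dotProduct_eq_zero x h, fun x h => dotProduct_eq_zero x fun w => ?_⟩
  rw [dotProduct_comm]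
  exact h w

lemma dualCode_eq_orthogonal (C : Submodule K (ι → K)) :
    dualCode C = (dotForm K ι).orthogonal C := by
  ext x
  change (∀ c ∈ C, x ⬝ᵥ c = 0) ↔ (∀ c ∈ C, c ⬝ᵥ x = 0)
  simp_rw [dotProduct_comm x]

lemma dualCode_dualCode (C : Submodule K (ι → K)) : dualCode (dualCode C) = C := by
  rw [dualCode_eq_orthogonal, dualCode_eq_orthogonal,
    LinearMap.BilinForm.orthogonal_orthogonal dotForm_nondegenerate dotForm_isRefl]

lemma finrank_dualCode (C : Submodule K (ι → K)) :
    Module.finrank K (dualCode C) = Fintype.card ι - Module.finrank K C := by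
  rw [dualCode_eq_orthogonal, LinearMap.BilinForm.finrank_orthogonal dotForm_nondegenerate,
    Module.finrank_fintype_fun_eq_card]

end Dual

/-! ### Cyclic codes through the zeros of their generator -/

lemma mem_cyclicCode_iff_dvd {K : Type*} [Field K] {n : ℕ} {g : K[X]} (hg : g ∣ X ^ n - 1)
    (c : Fin n → K) : c ∈ cyclicCode n g ↔ g ∣ toPoly K n c := by
  change Ideal.Quotient.mk (Ideal.span {(X ^ n - 1 : K[X])}) (toPoly K n c) ∈
    Ideal.span {Ideal.Quotient.mk (Ideal.span {(X ^ n - 1 : K[X])}) g} ↔ _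
  rw [Ideal.mem_span_singleton]
  constructor
  · rintro ⟨q, hq⟩
    obtain ⟨q, rfl⟩ := Ideal.Quotient.mk_surjective q
    rw [← map_mul, Ideal.Quotient.mk_eq_mk_iff_sub_mem, Ideal.mem_span_singleton] at hq
    exact (dvd_sub_left (Dvd.intro q rfl)).1 (hg.trans hq)
  · exact fun h => map_dvd _ h

lemma aeval_toPoly {K A : Type*} [Field K] [CommRing A] [Algebra K A] {n : ℕ} (c : Fin n → K)
    (β : A) : aeval β (toPoly K n c) = ∑ i, algebraMap K A (c i) * β ^ (i : ℕ) := by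
  simp [toPoly, LinearMap.sum_apply, aeval_monomial]

section Code

variable {F : Type*} [Field F] [Fintype F] [Algebra (ZMod 2) F]

omit [Algebra (ZMod 2) F] in
lemma orderOf_generator {m : ℕ} (hF : Fintype.card F = 2 ^ m) {α : Fˣ}
    (hα : ∀ x : Fˣ, x ∈ Subgroup.zpowers α) : orderOf α = 2 ^ m - 1 := by
  rw [orderOf_eq_card_of_forall_mem_zpowers hα, card_units_eq hF]

/-- If `α` and `α ^ (1 + 2 ^ e)` were conjugate, then `x ↦ x ^ (1 + 2 ^ e)` would be additive, which
forces `x ^ 2 ^ e = x` for all `x`. -/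
lemma isCoprime_minpoly_pow {m e : ℕ} (he0 : e ≠ 0) (hem : e < m) (hF : Fintype.card F = 2 ^ m)
    {α : Fˣ} (hα : ∀ x : Fˣ, x ∈ Subgroup.zpowers α) :
    IsCoprime (minpoly (ZMod 2) (α : F)) (minpoly (ZMod 2) ((α : F) ^ (1 + 2 ^ e))) := by
  have : CharP F 2 := charP_of_injective_algebraMap (algebraMap (ZMod 2) F).injective 2
  have hint : ∀ x : F, IsIntegral (ZMod 2) x := fun x => Algebra.IsIntegral.isIntegral x
  rw [(minpoly.irreducible (hint _)).coprime_iff_not_dvd]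
  intro hdvd
  have heq : minpoly (ZMod 2) ((α : F) ^ (1 + 2 ^ e)) = minpoly (ZMod 2) (α : F) :=
    minpoly.eq_of_irreducible_of_monic (minpoly.irreducible (hint _))
      (aeval_eq_zero_of_dvd_aeval_eq_zero hdvd (minpoly.aeval _ _)) (minpoly.monic (hint _))
  obtain ⟨σ, hσ⟩ := isConjRoot_iff_exists_algEquiv.1 (show IsConjRoot (ZMod 2) _ _ from heq)
  have hpow : ∀ x : F, σ x = x ^ (1 + 2 ^ e) := by
    intro x
    by_cases h0 : x = 0
    · subst h0
      simp
    · obtain ⟨j, hj⟩ := hα (Units.mk0 x h0)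
      have hx : x = (α : F) ^ j := by
        rw [← Units.val_zpow_eq_zpow_val]
        exact (congrArg Units.val hj).symm
      rw [hx, map_zpow₀, hσ, ← zpow_natCast, ← zpow_natCast, ← zpow_mul, ← zpow_mul, mul_comm]
  have hfix : (α : F) ^ 2 ^ e = α := by
    have h1 := map_add σ (α : F) 1
    rw [map_one, hpow, hpow, pow_add, pow_add, pow_one, pow_one, ← frob_apply, map_add, map_one,
      frob_apply] at h1
    have h2 : (α : F) ^ 2 ^ e + α = 0 := by linear_combination h1
    exact CharTwo.add_eq_zero.1 h2
  have hone : α ^ (2 ^ e - 1) = 1 := by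
    have h1 : (2 ^ e - 1) + 1 = 2 ^ e := Nat.sub_add_cancel Nat.one_le_two_pow
    have h2 : α ^ (2 ^ e - 1) * α = α := by
      rw [← pow_succ, h1]
      ext
      exact_mod_cast hfix
    exact mul_eq_right.1 h2
  have hle := Nat.le_of_dvd (Nat.sub_pos_of_lt (Nat.one_lt_two_pow he0))
    (orderOf_dvd_of_pow_eq_one hone)
  rw [orderOf_generator hF hα] at hle
  have h3 : 2 ^ e < 2 ^ m := Nat.pow_lt_pow_right one_lt_two hem
  have h4 : 1 ≤ 2 ^ e := Nat.one_le_two_pow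
  omega

lemma genPoly_singleton (α : Fˣ) (e : ℕ) : genPoly α {e} =
    minpoly (ZMod 2) (α : F) * minpoly (ZMod 2) ((α : F) ^ (1 + 2 ^ e)) := by
  rw [genPoly, Finset.lcm_singleton,
    (minpoly.monic (Algebra.IsIntegral.isIntegral _)).normalize_eq_self]

lemma mem_codeE_iff {m e : ℕ} (he0 : e ≠ 0) (hem : e < m) (hF : Fintype.card F = 2 ^ m)
    {α : Fˣ} (hα : ∀ x : Fˣ, x ∈ Subgroup.zpowers α) (c : Fin (2 ^ m - 1) → ZMod 2) :
    c ∈ codeE m α {e} ↔ ∑ i, algebraMap (ZMod 2) F (c i) * (α : F) ^ (i : ℕ) = 0 ∧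
      ∑ i, algebraMap (ZMod 2) F (c i) * ((α : F) ^ (i : ℕ)) ^ (1 + 2 ^ e) = 0 := by
  have hcop := isCoprime_minpoly_pow he0 hem hF hα
  have h1 : (α : F) ^ (2 ^ m - 1) = 1 := by
    rw [← orderOf_generator hF hα, ← Units.val_pow_eq_pow_val, pow_orderOf_eq_one, Units.val_one]
  have h2 : ((α : F) ^ (1 + 2 ^ e)) ^ (2 ^ m - 1) = 1 := by rw [pow_right_comm, h1, one_pow]
  have hg : genPoly α {e} ∣ (X ^ (2 ^ m - 1) - 1 : (ZMod 2)[X]) := by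
    rw [genPoly_singleton]
    refine hcop.mul_dvd (minpoly.dvd _ _ ?_) (minpoly.dvd _ _ ?_)
    · simp [h1]
    · simp [h2]
  rw [codeE, mem_cyclicCode_iff_dvd hg, genPoly_singleton]
  have h3 : ∀ i : ℕ, ((α : F) ^ (1 + 2 ^ e)) ^ i = ((α : F) ^ i) ^ (1 + 2 ^ e) :=
    fun i => pow_right_comm _ _ _
  simp_rw [← h3]
  rw [← aeval_toPoly, ← aeval_toPoly]
  constructor
  · intro h
    exact ⟨(minpoly.dvd_iff).1 (dvd_of_mul_right_dvd h),
      (minpoly.dvd_iff).1 (dvd_of_mul_left_dvd h)⟩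
  · rintro ⟨h4, h5⟩
    exact hcop.mul_dvd (minpoly.dvd _ _ h4) (minpoly.dvd _ _ h5)

/-- The field element attached to a coordinate of the extended code: `α ^ i` for `i < n`, and `0`
for the last coordinate. -/
def point (α : Fˣ) (n : ℕ) : Fin (n + 1) → F :=
  Fin.snoc (α := fun _ => F) (fun i : Fin n => (α : F) ^ (i : ℕ)) 0

omit [Fintype F] [Algebra (ZMod 2) F] in
lemma point_castSucc (α : Fˣ) (n : ℕ) (i : Fin n) : point α n i.castSucc = (α : F) ^ (i : ℕ) :=
  Fin.snoc_castSucc (α := fun _ => F) _ _ _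

omit [Fintype F] [Algebra (ZMod 2) F] in
lemma point_last (α : Fˣ) (n : ℕ) : point α n (Fin.last n) = 0 :=
  Fin.snoc_last (α := fun _ => F) _ _

omit [Algebra (ZMod 2) F] in
lemma point_bijective {m : ℕ} (hF : Fintype.card F = 2 ^ m) {α : Fˣ}
    (hα : ∀ x : Fˣ, x ∈ Subgroup.zpowers α) : Function.Bijective (point α (2 ^ m - 1)) := by
  rw [Fintype.bijective_iff_injective_and_card]
  constructor
  · intro i j
    refine Fin.lastCases ?_ (fun i => ?_) i <;> refine Fin.lastCases ?_ (fun j => ?_) j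
    · simp
    · rw [point_castSucc, point_last]
      intro h
      exact absurd h.symm (pow_ne_zero _ α.ne_zero)
    · rw [point_castSucc, point_last]
      intro h
      exact absurd h (pow_ne_zero _ α.ne_zero)
    · rw [point_castSucc, point_castSucc]
      intro h
      have h' : α ^ (i : ℕ) = α ^ (j : ℕ) := by
        ext
        exact_mod_cast h
      have hij := pow_injOn_Iio_orderOf (x := α) (by simp [orderOf_generator hF hα])
        (by simp [orderOf_generator hF hα]) h'
      rw [Fin.ext hij]
  · rw [Fintype.card_fin, hF, Nat.sub_add_cancel Nat.one_le_two_pow]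

/-- The extended code consists of the vectors orthogonal to `1`, `x` and `x ^ (1 + 2 ^ e)`, where
`x` runs over the points of the field. -/
lemma mem_extendedCode_iff {m e : ℕ} (he0 : e ≠ 0) (hem : e < m) (hF : Fintype.card F = 2 ^ m)
    {α : Fˣ} (hα : ∀ x : Fˣ, x ∈ Subgroup.zpowers α) (d : Fin (2 ^ m - 1 + 1) → ZMod 2) :
    d ∈ extendedCode (codeE m α {e}) ↔ ∑ i, d i = 0 ∧
      ∑ i, algebraMap (ZMod 2) F (d i) * point α (2 ^ m - 1) i = 0 ∧
      ∑ i, algebraMap (ZMod 2) F (d i) * point α (2 ^ m - 1) i ^ (1 + 2 ^ e) = 0 := by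
  change ((fun i : Fin (2 ^ m - 1) => d i.castSucc) ∈ codeE m α {e} ∧
    d (Fin.last _) = -∑ i : Fin (2 ^ m - 1), d i.castSucc) ↔ _
  rw [mem_codeE_iff he0 hem hF hα]
  simp only [Fin.sum_univ_castSucc, point_castSucc, point_last, mul_zero, add_zero]
  rw [zero_pow (Nat.add_pos_left one_pos _).ne', mul_zero, add_zero, and_comm,
    eq_neg_iff_add_eq_zero, add_comm (d (Fin.last _))]

/-! ### The trace code -/

/-- The map which sends `(a, b, c)` to the vector of values of `Tr (a x ^ (1 + 2 ^ e) + b x) + c` at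
the points `ρ i`. -/
noncomputable def traceWord {ι : Type*} (e : ℕ) (ρ : ι → F) :
    (F × F × ZMod 2) →ₗ[ZMod 2] (ι → ZMod 2) where
  toFun p i := quadFun e p.1 p.2.1 (ρ i) + p.2.2
  map_add' p q := by
    ext i
    simp only [quadFun, Prod.fst_add, Prod.snd_add, Pi.add_apply]
    rw [add_add_add_comm, ← map_add (Algebra.trace (ZMod 2) F)]
    congr 2
    ring
  map_smul' r p := by
    ext i
    simp only [quadFun, Prod.smul_fst, Prod.smul_snd, Pi.smul_apply, RingHom.id_apply, smul_add]
    rw [← map_smul (Algebra.trace (ZMod 2) F), smul_add, smul_mul_assoc, smul_mul_assoc]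

omit [Fintype F] in
lemma traceWord_apply {ι : Type*} (e : ℕ) (ρ : ι → F) (a b : F) (c : ZMod 2) (i : ι) :
    traceWord e ρ (a, b, c) i = quadFun e a b (ρ i) + c := rfl

omit [Fintype F] in
lemma sum_mul_tr {ι : Type*} [Fintype ι] (d : ι → ZMod 2) (f : ι → F) (a : F) :
    ∑ i, d i * tr (a * f i) = tr (a * ∑ i, algebraMap (ZMod 2) F (d i) * f i) := by
  rw [Finset.mul_sum, tr, map_sum]
  refine Finset.sum_congr rfl fun i _ => ?_
  rw [← smul_eq_mul, ← map_smul, Algebra.smul_def]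
  congr 1
  ring

lemma mem_dualCode_range_traceWord_iff {ι : Type*} [Fintype ι] (e : ℕ) (ρ : ι → F)
    (d : ι → ZMod 2) : d ∈ dualCode (LinearMap.range (traceWord e ρ)) ↔ ∑ i, d i = 0 ∧
      ∑ i, algebraMap (ZMod 2) F (d i) * ρ i = 0 ∧
      ∑ i, algebraMap (ZMod 2) F (d i) * ρ i ^ (1 + 2 ^ e) = 0 := by
  have key : ∀ a b c, d ⬝ᵥ traceWord e ρ (a, b, c)
      = tr (a * ∑ i, algebraMap (ZMod 2) F (d i) * ρ i ^ (1 + 2 ^ e))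
        + tr (b * ∑ i, algebraMap (ZMod 2) F (d i) * ρ i) + (∑ i, d i) * c := by
    intro a b c
    rw [← sum_mul_tr, ← sum_mul_tr, Finset.sum_mul, ← Finset.sum_add_distrib,
      ← Finset.sum_add_distrib]
    refine Finset.sum_congr rfl fun i _ => ?_
    rw [traceWord_apply, quadFun, tr, map_add]
    ring
  change (∀ c ∈ LinearMap.range (traceWord e ρ), d ⬝ᵥ c = 0) ↔ _
  have h0 : ∀ z : F, tr (0 * z) = 0 := fun z => by rw [zero_mul]; exact map_zero _
  constructor
  · intro h
    have h' : ∀ a b c, d ⬝ᵥ traceWord e ρ (a, b, c) = 0 := fun a b c => h _ ⟨_, rfl⟩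
    simp_rw [key] at h'
    refine ⟨?_, tr_mul_eq_zero fun b => ?_, tr_mul_eq_zero fun a => ?_⟩
    · simpa only [h0, zero_add, mul_one] using h' 0 0 1
    · simpa only [h0, zero_add, mul_zero, add_zero] using h' 0 b 0
    · simpa only [h0, mul_zero, add_zero] using h' a 0 0
  · rintro ⟨h1, h2, h3⟩ _ ⟨⟨a, b, c⟩, rfl⟩
    have ht : tr (0 : F) = 0 := map_zero _
    rw [key, h1, h2, h3, mul_zero, mul_zero, ht, zero_mul, add_zero, add_zero]

lemma extendedCode_eq {m e : ℕ} (he0 : e ≠ 0) (hem : e < m) (hF : Fintype.card F = 2 ^ m)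
    {α : Fˣ} (hα : ∀ x : Fˣ, x ∈ Subgroup.zpowers α) : extendedCode (codeE m α {e})
      = dualCode (LinearMap.range (traceWord e (point α (2 ^ m - 1)))) := by
  ext d
  rw [mem_extendedCode_iff he0 hem hF hα, mem_dualCode_range_traceWord_iff]

/-! ### The minimum distance of the extended code -/

omit [Fintype F] in
/-- A nonzero vector with `∑ d i = 0` and `∑ d i * ρ i = 0` has even weight, and its weight is not
`2` because the points `ρ i` are distinct. -/
lemma four_le_hammingNorm {ι : Type*} [Fintype ι] {ρ : ι → F} (hρ : Function.Injective ρ)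
    {d : ι → ZMod 2} (hd : d ≠ 0) (h1 : ∑ i, d i = 0)
    (h2 : ∑ i, algebraMap (ZMod 2) F (d i) * ρ i = 0) : 4 ≤ hammingNorm d := by
  classical
  have : CharP F 2 := charP_of_injective_algebraMap (algebraMap (ZMod 2) F).injective 2
  have hd1 : ∀ i, d i = if d i ≠ 0 then 1 else 0 := by
    intro i
    rcases zmod_two_eq_zero_or_one (d i) with h | h <;> simp [h]
  have heven : 2 ∣ hammingNorm d := by
    have h := Finset.sum_congr (rfl : (Finset.univ : Finset ι) = _) fun i _ => hd1 i
    rw [h1, Finset.sum_boole] at h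
    rw [← CharP.cast_eq_zero_iff (ZMod 2) 2]
    exact h.symm
  have hpos : hammingNorm d ≠ 0 := hammingNorm_ne_zero_iff.2 hd
  have htwo : hammingNorm d ≠ 2 := by
    intro h
    obtain ⟨i, j, hij, hs⟩ := Finset.card_eq_two.1 h
    have h3 : ∑ i, algebraMap (ZMod 2) F (d i) * ρ i = ∑ i with d i ≠ 0, ρ i := by
      rw [Finset.sum_filter]
      refine Finset.sum_congr rfl fun i _ => ?_
      rcases zmod_two_eq_zero_or_one (d i) with h | h <;> simp [h]
    rw [h3, hs, Finset.sum_pair hij] at h2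
    exact hij (hρ (CharTwo.add_eq_zero.1 h2))
  omega

/-- The subfield with four elements supports a codeword: there `x ^ 2 ^ e = x` as `e` is even, so
that the sums of `x` and of `x ^ (1 + 2 ^ e) = x ^ 2` over it vanish. -/
lemma exists_hammingNorm_eq_four {ι : Type*} [Fintype ι] {m e : ℕ} (hm : Even m) (he : Even e)
    (hF : Fintype.card F = 2 ^ m) {α : Fˣ} (hα : ∀ x : Fˣ, x ∈ Subgroup.zpowers α)
    (hm0 : m ≠ 0) {ρ : ι → F} (hρ : Function.Bijective ρ) :
    ∃ d : ι → ZMod 2, hammingNorm d = 4 ∧ ∑ i, d i = 0 ∧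
      ∑ i, algebraMap (ZMod 2) F (d i) * ρ i = 0 ∧
      ∑ i, algebraMap (ZMod 2) F (d i) * ρ i ^ (1 + 2 ^ e) = 0 := by
  classical
  have : CharP F 2 := charP_of_injective_algebraMap (algebraMap (ZMod 2) F).injective 2
  have h3 : ∀ k : ℕ, Even k → 3 ∣ 2 ^ k - 1 := by
    rintro k ⟨l, rfl⟩
    rw [← two_mul, pow_mul]
    simpa using Nat.sub_dvd_pow_sub_pow 4 1 l
  obtain ⟨ω, hω⟩ : ∃ ω : Fˣ, orderOf ω = 3 := by
    obtain ⟨q, hq⟩ := h3 m hm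
    have hpos : 0 < 2 ^ m - 1 := Nat.sub_pos_of_lt (Nat.one_lt_two_pow hm0)
    refine ⟨α ^ q, ?_⟩
    rw [orderOf_pow_of_dvd (by rintro rfl; omega) (by rw [orderOf_generator hF hα, hq]; simp),
      orderOf_generator hF hα, hq, Nat.mul_div_cancel]
    exact Nat.pos_of_ne_zero (by rintro rfl; omega)
  have hw3 : (ω : F) ^ 3 = 1 := by
    have := pow_orderOf_eq_one ω
    rw [hω] at this
    rw [← Units.val_pow_eq_pow_val, this, Units.val_one]
  have hw1 : (ω : F) ≠ 1 := by
    intro h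
    rw [Units.val_eq_one.1 h, orderOf_one] at hω
    omega
  have hw0 : (ω : F) ≠ 0 := ω.ne_zero
  have hsum : 1 + (ω : F) + ω ^ 2 = 0 := by
    have h : ((ω : F) - 1) * (1 + ω + ω ^ 2) = 0 := by linear_combination hw3
    exact (mul_eq_zero.1 h).resolve_left (sub_ne_zero.2 hw1)
  have hw2 : (ω : F) ^ 2 ≠ 1 := by
    intro h
    apply hw1
    linear_combination hw3 - (ω : F) * h
  have hw21 : (ω : F) ≠ (ω : F) ^ 2 := by
    intro h
    apply hw1
    apply mul_left_cancel₀ hw0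
    linear_combination - h
  have hfix : (ω : F) ^ 2 ^ e = ω := by
    obtain ⟨q, hq⟩ := h3 e he
    have : 2 ^ e = 3 * q + 1 := by
      have : 1 ≤ 2 ^ e := Nat.one_le_two_pow
      omega
    rw [this, pow_succ, pow_mul, hw3, one_pow, one_mul]
  let S : Finset F := {0, 1, (ω : F), (ω : F) ^ 2}
  have hS : ∀ f : F → F, ∑ x ∈ S, f x = f 0 + (f 1 + (f ω + f (ω ^ 2))) := by
    intro f
    rw [Finset.sum_insert, Finset.sum_insert, Finset.sum_pair hw21]
    · simp [hw1.symm, hw2.symm]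
    · simp [hw0.symm, (pow_ne_zero 2 hw0).symm]
  have hcard : S.card = 4 := by
    rw [Finset.card_insert_of_notMem, Finset.card_insert_of_notMem, Finset.card_pair hw21]
    · simp [hw1.symm, hw2.symm]
    · simp [hw0.symm, (pow_ne_zero 2 hw0).symm]
  have hsupp : ∀ f : F → F, ∑ i, algebraMap (ZMod 2) F (if ρ i ∈ S then 1 else 0) * f (ρ i)
      = ∑ x ∈ S, f x := by
    intro f
    rw [hρ.sum_comp fun x => algebraMap (ZMod 2) F (if x ∈ S then 1 else 0) * f x]
    simp [apply_ite (algebraMap (ZMod 2) F)]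
  have hnorm : hammingNorm (fun i => if ρ i ∈ S then (1 : ZMod 2) else 0) = 4 := by
    rw [hammingNorm, ← hcard, Finset.card_filter]
    rw [hρ.sum_comp fun x => if (if x ∈ S then (1 : ZMod 2) else 0) ≠ 0 then 1 else 0]
    simp
  refine ⟨fun i => if ρ i ∈ S then 1 else 0, hnorm, ?_, ?_, ?_⟩
  · rw [hρ.sum_comp fun x => if x ∈ S then (1 : ZMod 2) else 0]
    simp only [Finset.sum_ite_mem, Finset.univ_inter, Finset.sum_const, hcard]
    decide
  · rw [hsupp fun x => x, hS]
    linear_combination hsum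
  · rw [hsupp fun x => x ^ (1 + 2 ^ e), hS, zero_pow (Nat.add_pos_left one_pos _).ne', one_pow,
      pow_right_comm, pow_add, pow_one, hfix]
    linear_combination hsum + ω * hw3

/-! ### The weights of the trace code -/

lemma sum_sgn_eq_card_sub {ι : Type*} [Fintype ι] (d : ι → ZMod 2) :
    ∑ i, sgn (d i) = (Fintype.card ι : ℤ) - 2 * hammingNorm d := by
  have h : ∀ i, sgn (d i) = 1 - 2 * (if d i ≠ 0 then 1 else 0) := by
    intro i
    rcases zmod_two_eq_zero_or_one (d i) with h | h <;> simp [h, sgn_one]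
  simp_rw [h, Finset.sum_sub_distrib, ← Finset.mul_sum]
  rw [hammingNorm, Finset.card_filter]
  simp

variable {ι : Type*} [Fintype ι] {ρ : ι → F} (hρ : Function.Bijective ρ)

include hρ

lemma two_mul_hammingNorm_traceWord (e : ℕ) (a b : F) (c : ZMod 2) :
    2 * (hammingNorm (traceWord e ρ (a, b, c)) : ℤ) = Fintype.card F - sgn c * walsh e a b := by
  have h := sum_sgn_eq_card_sub (traceWord e ρ (a, b, c))
  simp_rw [traceWord_apply, sgn_add] at h
  rw [hρ.sum_comp fun x => sgn (quadFun e a b x) * sgn c, ← Finset.sum_mul,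
    Fintype.card_of_bijective hρ] at h
  rw [walsh]
  linarith

variable {m e : ℕ} (hm4 : m % 4 = 0) (hgcd : Nat.gcd m e = 2) (hF : Fintype.card F = 2 ^ m)
  (hm : 8 ≤ m)

include hm4 hgcd hF hm

lemma traceWord_injective : Function.Injective (traceWord e ρ) := by
  classical
  rw [injective_iff_map_eq_zero]
  rintro ⟨a, b, c⟩ h
  have h1 := two_mul_hammingNorm_traceWord hρ e a b c
  rw [h, hammingNorm_zero, hF] at h1
  push_cast at h1
  have hW : ∀ a' b' : F, walsh e a' b' ^ 2 = 2 ^ m * 2 ^ m → (a', b') ∈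
      Finset.univ.filter fun p : F × F => walsh e p.1 p.2 ^ 2 = 2 ^ m * 2 ^ m := by
    intro a' b' h
    simpa using h
  -- `(a, b)` and `(0, 0)` both lie in the one-element set of pairs with `W ^ 2 = 2 ^ m * 2 ^ m`
  obtain ⟨p, hp⟩ := Finset.card_eq_one.1
    (card_walsh_sq_eq_two_pow_mul_two_pow (F := F) hm4 hgcd hF hm)
  have h00 : walsh e (0 : F) 0 = 2 ^ m := by
    have h0 : ∀ x : F, quadFun e 0 0 x = 0 := fun x => by
      rw [quadFun, zero_mul, zero_mul, add_zero]
      exact map_zero _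
    simp [walsh, h0, hF]
  have hab : (a, b) = p := by
    have := hW a b (by
      have : sgn c * sgn c = 1 := by rw [← sgn_add, CharTwo.add_self_eq_zero, sgn_zero]
      linear_combination (2 ^ m + sgn c * walsh e a b) * h1 - this * walsh e a b ^ 2)
    rw [hp] at this
    exact Finset.mem_singleton.1 this
  have h0 : ((0 : F), (0 : F)) = p := by
    have := hW 0 0 (by rw [h00, sq])
    rw [hp] at this
    exact Finset.mem_singleton.1 this
  obtain ⟨rfl, rfl⟩ := Prod.mk.inj (hab.trans h0.symm)
  rw [h00] at h1
  rcases zmod_two_eq_zero_or_one c with rfl | rfl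
  · rfl
  · rw [sgn_one] at h1
    have : (0 : ℤ) < 2 ^ m := by positivity
    omega

lemma finrank_range_traceWord :
    Module.finrank (ZMod 2) (LinearMap.range (traceWord e ρ)) = 2 * m + 1 := by
  have h : Module.finrank (ZMod 2) F = m := by
    have h := Module.card_eq_pow_finrank (K := ZMod 2) (V := F)
    rw [hF, ZMod.card] at h
    exact (Nat.pow_right_injective le_rfl h).symm
  rw [LinearMap.finrank_range_of_inj (traceWord_injective hρ hm4 hgcd hF hm),
    Module.finrank_prod, Module.finrank_prod, h, Module.finrank_self]
  ring

open Classical in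
/-- The two values of the constant term give complementary codewords, of weights
`(2 ^ m - W) / 2` and `(2 ^ m + W) / 2`. -/
lemma weightCount_range_traceWord (w : ℕ) :
    weightCount (LinearMap.range (traceWord e ρ)) w
      = (Finset.univ.filter fun p : F × F => walsh e p.1 p.2 = 2 ^ m - 2 * w).card
        + (Finset.univ.filter fun p : F × F => walsh e p.1 p.2 = -(2 ^ m - 2 * w)).card := by
  have h1 : {c : ι → ZMod 2 | c ∈ LinearMap.range (traceWord e ρ) ∧ hammingNorm c = w}
      = traceWord e ρ '' {p | hammingNorm (traceWord e ρ p) = w} := by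
    ext c
    constructor
    · rintro ⟨⟨p, rfl⟩, hp⟩
      exact ⟨p, hp, rfl⟩
    · rintro ⟨p, hp, rfl⟩
      exact ⟨⟨p, rfl⟩, hp⟩
  rw [weightCount, h1, Set.ncard_image_of_injective _ (traceWord_injective hρ hm4 hgcd hF hm),
    Set.ncard_eq_toFinset_card', Set.toFinset_ofPred, Finset.card_filter, Finset.card_filter,
    Finset.card_filter, Fintype.sum_prod_type, Fintype.sum_prod_type, Fintype.sum_prod_type,
    ← Finset.sum_add_distrib]
  refine Finset.sum_congr rfl fun a _ => ?_
  rw [Fintype.sum_prod_type, ← Finset.sum_add_distrib]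
  refine Finset.sum_congr rfl fun b _ => ?_
  have h2 : ∀ f : ZMod 2 → ℕ, ∑ c, f c = f 0 + f 1 := fun f => Fin.sum_univ_two f
  have h3 := two_mul_hammingNorm_traceWord hρ e a b 0
  have h4 := two_mul_hammingNorm_traceWord hρ e a b 1
  rw [hF] at h3 h4
  push_cast [sgn_zero, sgn_one] at h3 h4
  rw [h2]
  congr 1
  · refine if_congr ?_ rfl rfl
    dsimp only
    omega
  · refine if_congr ?_ rfl rfl
    dsimp only
    omega

open Classical in
lemma weightCount_range_traceWord_of_ne (w : ℕ) (hw : (2 : ℤ) ^ m - 2 * w ≠ 0) :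
    weightCount (LinearMap.range (traceWord e ρ)) w
      = (Finset.univ.filter fun p : F × F => walsh e p.1 p.2 ^ 2 = (2 ^ m - 2 * w) ^ 2).card := by
  rw [weightCount_range_traceWord hρ hm4 hgcd hF hm, Finset.card_filter, Finset.card_filter,
    Finset.card_filter, ← Finset.sum_add_distrib]
  refine Finset.sum_congr rfl fun p _ => ?_
  simp only [sq_eq_sq_iff_eq_or_eq_neg]
  split_ifs <;> omega

open Classical in
lemma weightCount_range_traceWord_half :
    weightCount (LinearMap.range (traceWord e ρ)) (2 ^ (m - 1))
      = 2 * (Finset.univ.filter fun p : F × F => walsh e p.1 p.2 ^ 2 = 0).card := by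
  have h : (2 : ℤ) ^ m - 2 * (2 ^ (m - 1) : ℕ) = 0 := by
    push_cast
    rw [← pow_succ', Nat.sub_add_cancel (by omega), sub_self]
  rw [weightCount_range_traceWord hρ hm4 hgcd hF hm, h, neg_zero, two_mul]
  simp only [sq_eq_zero_iff]

end Code

/-! ### Parameters and weight distribution -/

section Distribution

variable {F : Type*} [Field F] [Fintype F] [Algebra (ZMod 2) F] {ι : Type*} [Fintype ι]
  {ρ : ι → F} (hρ : Function.Bijective ρ) {m e : ℕ} (hm4 : m % 4 = 0) (hgcd : Nat.gcd m e = 2)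
  (hF : Fintype.card F = 2 ^ m) (hm : 8 ≤ m)

include hρ hm4 hgcd hF hm

lemma weightCount_range_traceWord_of_sq_eq_one (w : ℕ)
    (hw : ((2 : ℤ) ^ m - 2 * w) ^ 2 = 2 ^ m * 2 ^ m) :
    weightCount (LinearMap.range (traceWord e ρ)) w = 1 := by
  classical
  have h0 : (2 : ℤ) ^ m * 2 ^ m ≠ 0 := by positivity
  rw [weightCount_range_traceWord_of_ne hρ hm4 hgcd hF hm w fun h => h0 (by rw [← hw, h]; simp),
    hw, card_walsh_sq_eq_two_pow_mul_two_pow hm4 hgcd hF hm]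

lemma weightCount_range_traceWord_of_sq_eq_two_pow (w : ℕ)
    (hw : ((2 : ℤ) ^ m - 2 * w) ^ 2 = 2 ^ m) :
    (weightCount (LinearMap.range (traceWord e ρ)) w : ℚ) = 2 ^ (m + 2) * (2 ^ m - 1) / 5 := by
  classical
  have h0 : (2 : ℤ) ^ m ≠ 0 := by positivity
  rw [weightCount_range_traceWord_of_ne hρ hm4 hgcd hF hm w fun h => h0 (by rw [← hw, h]; simp),
    hw]
  have h := congrArg (Nat.cast : ℕ → ℚ) (card_walsh_sq_eq_two_pow (F := F) hm4 hgcd hF hm)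
  push_cast [Nat.cast_sub Nat.one_le_two_pow] at h
  rw [pow_add]
  linarith

lemma weightCount_range_traceWord_of_sq_eq_two_pow_mul_sixteen (w : ℕ)
    (hw : ((2 : ℤ) ^ m - 2 * w) ^ 2 = 2 ^ m * 16) :
    (weightCount (LinearMap.range (traceWord e ρ)) w : ℚ) = 2 ^ (m - 4) * (2 ^ m - 1) / 5 := by
  classical
  have h0 : (2 : ℤ) ^ m * 16 ≠ 0 := by positivity
  rw [weightCount_range_traceWord_of_ne hρ hm4 hgcd hF hm w fun h => h0 (by rw [← hw, h]; simp),
    hw]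
  have h := congrArg (Nat.cast : ℕ → ℚ)
    (card_walsh_sq_eq_two_pow_mul_sixteen (F := F) hm4 hgcd hF hm)
  push_cast [Nat.cast_sub Nat.one_le_two_pow] at h
  have hp : (2 : ℚ) ^ m = 2 ^ (m - 4) * 16 := by
    rw [show (16 : ℚ) = 2 ^ 4 by norm_num, ← pow_add, Nat.sub_add_cancel (by omega)]
  have h5 : (2 : ℚ) ^ m * (2 ^ m - 1) = 16 * (2 ^ (m - 4) * (2 ^ m - 1)) := by
    linear_combination (2 ^ m - 1) * hp
  linarith

lemma weightCount_range_traceWord_two_pow_sub_one :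
    (weightCount (LinearMap.range (traceWord e ρ)) (2 ^ (m - 1)) : ℚ)
      = 2 * (3 * 2 ^ (m - 4) + 1) * (2 ^ m - 1) := by
  classical
  rw [weightCount_range_traceWord_half hρ hm4 hgcd hF hm]
  have h1 := congrArg (Nat.cast : ℕ → ℚ) (card_walsh_sq_eq_two_pow (F := F) hm4 hgcd hF hm)
  have h2 := congrArg (Nat.cast : ℕ → ℚ)
    (card_walsh_sq_eq_two_pow_mul_sixteen (F := F) hm4 hgcd hF hm)
  have h3 := congrArg (Nat.cast : ℕ → ℚ) (card_walsh_sq_add (F := F) hm4 hgcd hF hm)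
  rw [card_walsh_sq_eq_two_pow_mul_two_pow hm4 hgcd hF hm] at h3
  push_cast [Nat.cast_sub Nat.one_le_two_pow] at h1 h2 h3 ⊢
  have hp : (2 : ℚ) ^ m = 2 ^ (m - 4) * 16 := by
    rw [show (16 : ℚ) = 2 ^ 4 by norm_num, ← pow_add, Nat.sub_add_cancel (by omega)]
  rw [hp] at h1 h2 h3 ⊢
  linear_combination 2 * h3 - (2 / 5) * h1 - (1 / 40) * h2

lemma weightCount_range_traceWord_eq_zero (w : ℕ) (h0 : ((2 : ℤ) ^ m - 2 * w) ^ 2 ≠ 0)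
    (h1 : ((2 : ℤ) ^ m - 2 * w) ^ 2 ≠ 2 ^ m) (h2 : ((2 : ℤ) ^ m - 2 * w) ^ 2 ≠ 2 ^ m * 16)
    (h3 : ((2 : ℤ) ^ m - 2 * w) ^ 2 ≠ 2 ^ m * 2 ^ m) :
    weightCount (LinearMap.range (traceWord e ρ)) w = 0 := by
  classical
  rw [weightCount_range_traceWord_of_ne hρ hm4 hgcd hF hm w fun h => h0 (by rw [h]; simp),
    Finset.card_eq_zero, Finset.filter_eq_empty_iff]
  intro p _ hp
  rcases walsh_sq_eq hm4 hgcd hF p.1 p.2 with h | h | h | h <;> rw [h] at hp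
  exacts [h0 hp.symm, h1 hp.symm, h2 hp.symm, h3 hp.symm]

end Distribution

lemma weightCount_ne_zero_iff {K : Type*} [Field K] [DecidableEq K] [Finite K] {ι : Type*}
    [Fintype ι] (C : Submodule K (ι → K)) (w : ℕ) :
    weightCount C w ≠ 0 ↔ ∃ c ∈ C, hammingNorm c = w := by
  rw [weightCount, Ne, Set.ncard_eq_zero (Set.toFinite _), ← Ne, ← Set.nonempty_iff_ne_empty]
  rfl

end BinaryCode

open BinaryCode in
theorem mainTheorem3 {F : Type*} [Field F] [Finite F] [Algebra (ZMod 2) F]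
    (m e : ℕ) (hm : 8 ≤ m) (hm4 : m % 4 = 0) (he1 : 1 ≤ e) (he2 : e ≤ m / 2)
    (hgcd : Nat.gcd m e = 2) (hF : Nat.card F = 2 ^ m)
    (α : Fˣ) (hα : ∀ x : Fˣ, x ∈ Subgroup.zpowers α) :
    let C := BinaryCode.extendedCode (BinaryCode.codeE m α {e})
    let A := BinaryCode.weightCount (BinaryCode.dualCode C)
    BinaryCode.HasParameters (BinaryCode.dualCode C)
        (2 ^ m) (2 * m + 1) (2 ^ (m - 1) - 2 ^ ((m + 2) / 2)) ∧
      (A 0 = 1 ∧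
        (A (2 ^ (m - 1) - 2 ^ ((m + 2) / 2)) : ℚ) = 2 ^ (m - 4) * (2 ^ m - 1) / 5 ∧
        (A (2 ^ (m - 1) - 2 ^ ((m - 2) / 2)) : ℚ) = 2 ^ (m + 2) * (2 ^ m - 1) / 5 ∧
        (A (2 ^ (m - 1)) : ℚ) = 2 * (3 * 2 ^ (m - 4) + 1) * (2 ^ m - 1) ∧
        (A (2 ^ (m - 1) + 2 ^ ((m - 2) / 2)) : ℚ) = 2 ^ (m + 2) * (2 ^ m - 1) / 5 ∧
        (A (2 ^ (m - 1) + 2 ^ ((m + 2) / 2)) : ℚ) = 2 ^ (m - 4) * (2 ^ m - 1) / 5 ∧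
        A (2 ^ m) = 1 ∧
        ∀ w : ℕ, w ≠ 0 → w ≠ 2 ^ (m - 1) - 2 ^ ((m + 2) / 2) →
          w ≠ 2 ^ (m - 1) - 2 ^ ((m - 2) / 2) → w ≠ 2 ^ (m - 1) →
          w ≠ 2 ^ (m - 1) + 2 ^ ((m - 2) / 2) → w ≠ 2 ^ (m - 1) + 2 ^ ((m + 2) / 2) →
          w ≠ 2 ^ m → A w = 0) ∧
      BinaryCode.HasParameters C (2 ^ m) (2 ^ m - 1 - 2 * m) 4 := by
  intro C A
  have := Fintype.ofFinite F
  rw [Nat.card_eq_fintype_card] at hF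
  have he0 : e ≠ 0 := Nat.one_le_iff_ne_zero.1 he1
  have hem : e < m := by omega
  have hρ := point_bijective hF hα
  have hC : C = dualCode (LinearMap.range (traceWord e (point α (2 ^ m - 1)))) :=
    extendedCode_eq he0 hem hF hα
  have hD : dualCode C = LinearMap.range (traceWord e (point α (2 ^ m - 1))) := by
    rw [hC, dualCode_dualCode]
  have hlen : Fintype.card (Fin (2 ^ m - 1 + 1)) = 2 ^ m := by
    rw [Fintype.card_fin, Nat.sub_add_cancel Nat.one_le_two_pow]
  -- all the powers of `2` that occur are multiples of `z` or of `z ^ 2`, where `2 ^ m = 16 * z ^ 2`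
  obtain ⟨z, hz, hzm, hz1, hz2, hz3⟩ : ∃ z : ℕ, 4 ≤ z ∧ 2 ^ m = 16 * z ^ 2 ∧
      2 ^ (m - 1) = 8 * z ^ 2 ∧ 2 ^ ((m + 2) / 2) = 8 * z ∧ 2 ^ ((m - 2) / 2) = 2 * z := by
    refine ⟨2 ^ (m / 2 - 2), ?_, ?_, ?_, ?_, ?_⟩
    · exact Nat.pow_le_pow_right two_pos (show 2 ≤ m / 2 - 2 by omega)
    · rw [← pow_mul, show 16 = 2 ^ 4 by norm_num, ← pow_add]
      congr 1
      omega
    · rw [← pow_mul, show 8 = 2 ^ 3 by norm_num, ← pow_add]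
      congr 1
      omega
    · rw [show 8 = 2 ^ 3 by norm_num, ← pow_add]
      congr 1
      omega
    · rw [← pow_succ']
      congr 1
      omega
  have hzmZ : (2 : ℤ) ^ m = 16 * z ^ 2 := by exact_mod_cast hzm
  have hle : 8 * z ≤ 8 * z ^ 2 := by nlinarith
  have hA : A = weightCount (LinearMap.range (traceWord e (point α (2 ^ m - 1)))) := by
    rw [← hD]
  have hA0 : A 0 = 1 := by
    rw [hA]
    apply weightCount_range_traceWord_of_sq_eq_one hρ hm4 hgcd hF hm
    push_cast
    ring
  have hA1 : (A (2 ^ (m - 1) - 2 ^ ((m + 2) / 2)) : ℚ) = 2 ^ (m - 4) * (2 ^ m - 1) / 5 := by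
    rw [hA]
    apply weightCount_range_traceWord_of_sq_eq_two_pow_mul_sixteen hρ hm4 hgcd hF hm
    rw [hz1, hz2, hzmZ]
    push_cast [Nat.cast_sub hle]
    ring
  have hA2 : (A (2 ^ (m - 1) - 2 ^ ((m - 2) / 2)) : ℚ) = 2 ^ (m + 2) * (2 ^ m - 1) / 5 := by
    rw [hA]
    apply weightCount_range_traceWord_of_sq_eq_two_pow hρ hm4 hgcd hF hm
    rw [hz1, hz3, hzmZ]
    push_cast [Nat.cast_sub (show 2 * z ≤ 8 * z ^ 2 by omega)]
    ring
  have hA3 : (A (2 ^ (m - 1)) : ℚ) = 2 * (3 * 2 ^ (m - 4) + 1) * (2 ^ m - 1) := by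
    rw [hA]
    exact weightCount_range_traceWord_two_pow_sub_one hρ hm4 hgcd hF hm
  have hA4 : (A (2 ^ (m - 1) + 2 ^ ((m - 2) / 2)) : ℚ) = 2 ^ (m + 2) * (2 ^ m - 1) / 5 := by
    rw [hA]
    apply weightCount_range_traceWord_of_sq_eq_two_pow hρ hm4 hgcd hF hm
    rw [hz1, hz3, hzmZ]
    push_cast
    ring
  have hA5 : (A (2 ^ (m - 1) + 2 ^ ((m + 2) / 2)) : ℚ) = 2 ^ (m - 4) * (2 ^ m - 1) / 5 := by
    rw [hA]
    apply weightCount_range_traceWord_of_sq_eq_two_pow_mul_sixteen hρ hm4 hgcd hF hm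
    rw [hz1, hz2, hzmZ]
    push_cast
    ring
  have hA6 : A (2 ^ m) = 1 := by
    rw [hA]
    apply weightCount_range_traceWord_of_sq_eq_one hρ hm4 hgcd hF hm
    push_cast
    ring
  have hAw : ∀ w : ℕ, w ≠ 0 → w ≠ 2 ^ (m - 1) - 2 ^ ((m + 2) / 2) →
      w ≠ 2 ^ (m - 1) - 2 ^ ((m - 2) / 2) → w ≠ 2 ^ (m - 1) →
      w ≠ 2 ^ (m - 1) + 2 ^ ((m - 2) / 2) → w ≠ 2 ^ (m - 1) + 2 ^ ((m + 2) / 2) →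
      w ≠ 2 ^ m → A w = 0 := by
    intro w h0 h1 h2 h3 h4 h5 h6
    rw [hz1, hz2] at h1 h5
    rw [hz1, hz3] at h2 h4
    rw [hz1] at h3
    rw [hzm] at h6
    have hsq : ((z ^ 2 : ℕ) : ℤ) = (z : ℤ) ^ 2 := Nat.cast_pow z 2
    rw [hA]
    apply weightCount_range_traceWord_eq_zero hρ hm4 hgcd hF hm <;> rw [hzmZ]
    · rw [Ne, sq_eq_zero_iff]
      omega
    · rw [show (16 * z ^ 2 : ℤ) = (4 * z) ^ 2 by ring, Ne, sq_eq_sq_iff_eq_or_eq_neg,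
        show ((4 * z) ^ 2 : ℤ) = 16 * z ^ 2 by ring]
      omega
    · rw [show (16 * z ^ 2 * 16 : ℤ) = (16 * z) ^ 2 by ring, Ne, sq_eq_sq_iff_eq_or_eq_neg]
      omega
    · rw [← sq, Ne, sq_eq_sq_iff_eq_or_eq_neg]
      omega
  refine ⟨⟨hlen, ?_, ?_, ?_⟩, ⟨hA0, hA1, hA2, hA3, hA4, hA5, hA6, hAw⟩, ⟨hlen, ?_, ?_, ?_⟩⟩
  · rw [hD, finrank_range_traceWord hρ hm4 hgcd hF hm]
  · have hne : A (2 ^ (m - 1) - 2 ^ ((m + 2) / 2)) ≠ 0 := by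
      have h1 : (1 : ℚ) < 2 ^ m := one_lt_pow₀ one_lt_two (by omega)
      have h2 : (0 : ℚ) < 2 ^ (m - 4) * (2 ^ m - 1) / 5 := by
        have := sub_pos.2 h1
        positivity
      rw [← hA1] at h2
      exact_mod_cast h2.ne'
    obtain ⟨c, hc, hcw⟩ := (weightCount_ne_zero_iff _ _).1 hne
    refine ⟨c, hc, ?_, hcw⟩
    rw [← hammingNorm_ne_zero_iff, hcw, hz1, hz2]
    have : 8 * z < 8 * z ^ 2 := by nlinarith
    omega
  · rintro w ⟨c, hc, hc0, hcw⟩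
    by_contra! hlt
    have hw0 : w ≠ 0 := hcw ▸ hammingNorm_ne_zero_iff.2 hc0
    refine (weightCount_ne_zero_iff _ w).2 ⟨c, hc, hcw⟩ (hAw w hw0 ?_ ?_ ?_ ?_ ?_ ?_) <;>
      rw [hz1, hz2] at hlt <;> simp only [hz1, hz2, hz3, hzm] <;> omega
  · rw [hC, finrank_dualCode, hlen, finrank_range_traceWord hρ hm4 hgcd hF hm]
    omega
  · have h2e : 2 ∣ e := hgcd ▸ Nat.gcd_dvd_right m e
    obtain ⟨d, hd, h⟩ := exists_hammingNorm_eq_four (even_iff_two_dvd.2 (by omega))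
      (even_iff_two_dvd.2 h2e) hF hα (by omega) hρ
    refine ⟨d, (mem_extendedCode_iff he0 hem hF hα d).2 h, ?_, hd⟩
    rw [← hammingNorm_ne_zero_iff, hd]
    norm_num
  · rintro w ⟨c, hc, hc0, rfl⟩
    obtain ⟨h1, h2, -⟩ := (mem_extendedCode_iff he0 hem hF hα c).1 hc
    exact four_le_hammingNorm hρ.1 hc0 h1 h2
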